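/- Let $\Lambda=\mathbb Z\omega_1+\mathbb Z\omega_2\subset\mathbb C$ be a lattice (with $\omega_1,\omega_2$ linearly independent over $\mathbb R$), let $\wp$ be its Weierstrass $\wp$-function and $$\sigma(z)=z\prod_{l\in\Lambda\setminus\{0\}}\Bigl(1-\frac zl\Bigr)\exp\Bigl(\frac zl+\frac{z^2}{2l^2}\Bigr)$$ its Weierstrass $\sigma$-function. Let $\xi,\alpha,\beta\in\mathbb C$, put $\gamma=\beta-\alpha$, and assume that none of $\xi,\ \alpha,\ \beta,\ \gamma,\ \xi\pm\alpha,\ \xi\pm\beta,\ \xi\pm(\alpha-\beta)$ lies in $\Lambda$. Put $$(a,A)=(\wp(\alpha),\wp'(\alpha)),\qquad (b,B)=(\wp(\beta),\wp'(\beta)),\qquad (c,C)=(\wp(\gamma),\wp'(\gamma)),$$ assume $(A+B)\wp(\xi)-Ab-aB\neq0$, and put $$t=\frac{\sigma(\xi-\alpha)\,\sigma(\xi+\beta)\,\sigma(\xi+\alpha-\beta)}{\sigma(\xi+\alpha)\,\sigma(\xi-\beta)\,\sigma(\xi-\alpha+\beta)},\qquad s=\frac{1-t^2}{(A+B)\wp(\xi)-Ab-aB}.$$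 Then for all $X,Y,Z\in\mathbb C$ $$\begin{aligned} &(X-\wp(\xi+\alpha))(Y-\wp(\xi-\beta))(Z-\wp(\xi-\alpha+\beta))\\ &\quad-t^2(X-\wp(\xi-\alpha))(Y-\wp(\xi+\beta))(Z-\wp(\xi+\alpha-\beta))\\ &=s\Bigl[(-aB-bA)\bigl(\wp(\xi)(XY+YZ+XZ)+XYZ\bigr)+(b^2A+a^2B)\bigl(Z\wp(\xi)+XY\bigr)\\ &\quad+\bigl((b^2A+a^2B)-B(a-b)(a-c)\bigr)\bigl(X\wp(\xi)+YZ\bigr)\\ &\quad+\bigl(-A(b-a)(b-c)+(b^2A+a^2B)\bigr)\bigl(Y\wp(\xi)+XZ\bigr)\\ &\quad+\bigl(aB(a-b)(a-c)+bA(b-a)(b-c)-Ab^3-Ba^3\bigr)\bigl(\wp(\xi)+X+Y+Z\bigr)\\ &\quad+A\bigl(b^2-(a-b)(c-b)\bigr)^2+B\bigl(a^2-(b-a)(c-a)\bigr)^2-ABC(a-b)+(A+B)XYZ\,\wp(\xi)\Bigr]. \end{aligned}$$ -/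

import Mathlib

/-- The Weierstrass `σ`-function of the period lattice `Λ` of `L`:
`σ(z) = z ∏_{l ∈ Λ, l ≠ 0} (1 - z / l) exp (z / l + z² / (2 l²))`.
The product converges absolutely for every complex `z`. -/
noncomputable def PeriodPair.weierstrassSigma (L : PeriodPair) (z : ℂ) : ℂ :=
  z * ∏' l : {l : L.lattice // l ≠ 0},
    (1 - z / (l : ℂ)) * Complex.exp (z / (l : ℂ) + z ^ 2 / (2 * (l : ℂ) ^ 2))

/-!
Let `p = ℘(ξ)`, `P = ℘'(ξ)`, and let `y = m x + n` be the line through the points `(a, A)` and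
`(b, -B)` of the Weierstrass curve, with parameters `α` and `-β`. Everything rests on the function
`N(z) = σ(z - α) σ(z + β) σ(z + α - β)`, whose zeros sum to zero, so that `N / σ³` is elliptic with
at most a triple pole at the lattice points. The space of such functions is spanned by `℘'`, `℘`,
`1` (`exists_eq_derivWeierstrassP`), and the zeros at `α` and `-β` then force
`N = k σ³ (℘' - m ℘ - n)` with `k ≠ 0` (`exists_weierstrassSigma_mul_eq_line`). Consequently:

* `t = -V / U`, where `U = P + (m p + n)` and `V = P - (m p + n)`;
* multiplying the values of `N` at `z` and `-z`, and using that `σ(z + v) σ(z - v)` is a multiple of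
  `σ(z)² (℘(z) - ℘(v))` (`exists_weierstrassSigma_add_mul_sub`), one gets the factorisation
  `℘'² - (m ℘ + n)² = 4 (℘ - a) (℘ - b) (℘ - c)` and, by Vieta, `a + b + c = m² / 4`
  (`weierstrassP_collinear`). This contains the addition theorem (`weierstrassP_add`) and gives
  `U V = 4 (p - a) (p - b) (p - c)`.

With the six shifted values of `℘` given by the addition theorem, the claim becomes an algebraic
identity in `p, a, b, c, m, U, V` subject to `U V = 4 (p - a) (p - b) (p - c)` and
`a + b + c = m² / 4`. These relations determine `V` and `p` in terms of the independent quantities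
`p - a, p - b, p - c, m, U`, and in these coordinates the identity is checked by expansion
(`cubic_curve_identity`).

The dimension statement needs the absence of elliptic functions with a single simple pole. For an
odd one, this follows from its square being even, hence affine in `℘`, and vanishing at two
half-periods (`eq_zero_of_odd`), so no contour integral is needed. The quasi-periodicity of `σ`
comes from `(log σ)'' = -℘`, obtained by differentiating the locally uniformly convergent product.
-/

namespace PeriodPair

open Filter Topology

variable (L : PeriodPair)

/-! ### The Weierstrass `σ`-function as an entire function -/

/-- The Weierstrass primary factor of genus two, `(1 - x) exp (x + x² / 2)`. -/
noncomputable def primaryFactor (x : ℂ) : ℂ := (1 - x) * Complex.exp (x + x ^ 2 / 2)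

lemma norm_primaryFactor_sub_one_le {x : ℂ} (hx : ‖x‖ ≤ 1 / 2) :
    ‖primaryFactor x - 1‖ ≤ 12 * ‖x‖ ^ 3 := by
  set w : ℂ := x + x ^ 2 / 2 with hw
  have hx0 := norm_nonneg x
  have hw1 : ‖w‖ ≤ 5 / 4 * ‖x‖ := by
    calc ‖w‖ ≤ ‖x‖ + ‖x ^ 2 / 2‖ := norm_add_le _ _
      _ = ‖x‖ + ‖x‖ ^ 2 / 2 := by simp
      _ ≤ _ := by nlinarith
  have hw2 : ‖w‖ ≤ 1 := by linarith
  have hr : ‖Complex.exp w - (1 + w + w ^ 2 / 2)‖ ≤ 6 * ‖x‖ ^ 3 := by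
    have h := Complex.norm_exp_sub_sum_le_norm_mul_exp w 3
    simp only [Finset.sum_range_succ, Finset.sum_range_zero, Nat.factorial] at h
    norm_num at h
    have he : Real.exp ‖w‖ ≤ 3 :=
      (Real.exp_le_exp.mpr hw2).trans (by linarith [Real.exp_one_lt_d9])
    calc _ ≤ ‖w‖ ^ 3 * Real.exp ‖w‖ := h
      _ ≤ (5 / 4 * ‖x‖) ^ 3 * 3 := by gcongr
      _ ≤ _ := by nlinarith [pow_nonneg hx0 3]
  have key : primaryFactor x - 1 = (1 - x) * (Complex.exp w - (1 + w + w ^ 2 / 2))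
      + x ^ 3 * (-1 / 2 - 3 / 8 * x - x ^ 2 / 8) := by
    simp only [primaryFactor, ← hw]
    rw [hw]; ring
  have h1 : ‖1 - x‖ ≤ 3 / 2 := by
    calc _ ≤ ‖(1 : ℂ)‖ + ‖x‖ := norm_sub_le _ _
      _ ≤ _ := by rw [norm_one]; linarith
  have h2 : ‖-1 / 2 - 3 / 8 * x - x ^ 2 / 8‖ ≤ 1 := by
    calc _ ≤ ‖(-1 / 2 : ℂ)‖ + ‖3 / 8 * x‖ + ‖x ^ 2 / 8‖ :=
          (norm_sub_le _ _).trans (by gcongr; exact norm_sub_le _ _)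
      _ = 1 / 2 + 3 / 8 * ‖x‖ + ‖x‖ ^ 2 / 8 := by simp
      _ ≤ _ := by nlinarith
  rw [key]
  calc _ ≤ ‖1 - x‖ * ‖Complex.exp w - (1 + w + w ^ 2 / 2)‖
        + ‖x‖ ^ 3 * ‖-1 / 2 - 3 / 8 * x - x ^ 2 / 8‖ := by
        refine (norm_add_le _ _).trans (le_of_eq ?_); simp
    _ ≤ 3 / 2 * (6 * ‖x‖ ^ 3) + ‖x‖ ^ 3 * 1 := by gcongr
    _ ≤ _ := by nlinarith [pow_nonneg hx0 3]

/-- The factor `σ(z) / z` of the Weierstrass `σ`-function, as an entire function. -/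
noncomputable def sigmaQuotient (z : ℂ) : ℂ :=
  ∏' l : {l : L.lattice // l ≠ 0}, primaryFactor (z / (l : ℂ))

lemma weierstrassSigma_eq (z : ℂ) : L.weierstrassSigma z = z * L.sigmaQuotient z := by
  simp only [weierstrassSigma, sigmaQuotient, primaryFactor]
  congr! 5 with l
  ring

lemma summable_norm_inv_pow_three :
    Summable fun l : {l : L.lattice // l ≠ 0} ↦ ‖(l : ℂ)‖⁻¹ ^ 3 := by
  have h : Summable fun l : L.lattice ↦ ‖l‖ ^ (-3 : ℝ) :=
    ZLattice.summable_norm_rpow _ _ (by simp; norm_num)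
  refine (h.subtype {l | l ≠ 0}).congr fun l ↦ ?_
  simp only [Function.comp_apply]
  rw [Real.rpow_neg (norm_nonneg _), inv_pow]
  norm_cast

lemma eventually_cofinite_norm_le (r : ℝ) :
    ∀ᶠ l : {l : L.lattice // l ≠ 0} in cofinite, r ≤ ‖(l : ℂ)‖ := by
  have h : (Metric.closedBall (0 : L.lattice) r).Finite :=
    isCompact_iff_finite.mp (isCompact_closedBall (0 : L.lattice) r)
  refine (h.preimage Subtype.val_injective.injOn).subset fun l hl ↦ ?_
  have hl : ¬ r ≤ ‖(l : ℂ)‖ := hl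
  simpa using (not_le.mp hl).le

lemma eventually_cofinite_norm_primaryFactor_sub_one_le {r : ℝ} (hr : 0 < r) :
    ∀ᶠ l : {l : L.lattice // l ≠ 0} in cofinite, ∀ z ∈ Metric.ball (0 : ℂ) r,
      ‖primaryFactor (z / (l : ℂ)) - 1‖ ≤ 12 * r ^ 3 * ‖(l : ℂ)‖⁻¹ ^ 3 := by
  filter_upwards [L.eventually_cofinite_norm_le (2 * r)] with l hl z hz
  have hz : ‖z‖ < r := by simpa using hz
  have hl0 : 0 < ‖(l : ℂ)‖ := by linarith
  have h : ‖z / (l : ℂ)‖ ≤ r * ‖(l : ℂ)‖⁻¹ := by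
    rw [norm_div, div_eq_mul_inv]; gcongr
  refine (norm_primaryFactor_sub_one_le (h.trans ?_)).trans ?_
  · rw [← div_eq_mul_inv, div_le_iff₀ hl0]; linarith
  · calc _ ≤ 12 * (r * ‖(l : ℂ)‖⁻¹) ^ 3 := by gcongr
      _ = _ := by ring

lemma hasProdLocallyUniformlyOn_sigmaQuotient {r : ℝ} (hr : 0 < r) :
    HasProdLocallyUniformlyOn (fun (l : {l : L.lattice // l ≠ 0}) z ↦ primaryFactor (z / (l : ℂ)))
      L.sigmaQuotient (Metric.ball 0 r) := by
  have h := Summable.hasProdLocallyUniformlyOn_one_add (K := Metric.ball (0 : ℂ) r)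
    (f := fun (l : {l : L.lattice // l ≠ 0}) z ↦ primaryFactor (z / (l : ℂ)) - 1)
    Metric.isOpen_ball (L.summable_norm_inv_pow_three.mul_left (12 * r ^ 3))
    (L.eventually_cofinite_norm_primaryFactor_sub_one_le hr)
    (fun l ↦ by unfold primaryFactor; fun_prop)
  simpa only [add_sub_cancel] using! h

lemma tendstoLocallyUniformlyOn_sigmaQuotient {r : ℝ} (hr : 0 < r) :
    TendstoLocallyUniformlyOn
      (fun (s : Finset {l : L.lattice // l ≠ 0}) z ↦ ∏ l ∈ s, primaryFactor (z / (l : ℂ)))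
      L.sigmaQuotient atTop (Metric.ball 0 r) :=
  hasProdLocallyUniformlyOn_iff_tendstoLocallyUniformlyOn.mp
    (L.hasProdLocallyUniformlyOn_sigmaQuotient hr)

lemma differentiable_primaryFactor : Differentiable ℂ primaryFactor := by
  unfold primaryFactor; fun_prop

lemma differentiable_finsetProd_primaryFactor (s : Finset {l : L.lattice // l ≠ 0}) :
    Differentiable ℂ fun z ↦ ∏ l ∈ s, primaryFactor (z / (l : ℂ)) :=
  Differentiable.fun_finsetProd fun _ _ ↦
    differentiable_primaryFactor.comp (differentiable_id.div_const _)

lemma differentiable_sigmaQuotient : Differentiable ℂ L.sigmaQuotient := by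
  intro z
  have hr : 0 < ‖z‖ + 1 := by positivity
  exact ((L.tendstoLocallyUniformlyOn_sigmaQuotient hr).differentiableOn
    (.of_forall fun s ↦ (L.differentiable_finsetProd_primaryFactor s).differentiableOn)
    Metric.isOpen_ball).differentiableAt (Metric.isOpen_ball.mem_nhds (by simp))

lemma differentiable_weierstrassSigma : Differentiable ℂ L.weierstrassSigma := by
  rw [funext L.weierstrassSigma_eq]
  exact differentiable_id.mul L.differentiable_sigmaQuotient

lemma primaryFactor_ne_zero {x : ℂ} (hx : x ≠ 1) : primaryFactor x ≠ 0 :=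
  mul_ne_zero (sub_ne_zero.mpr hx.symm) (Complex.exp_ne_zero _)

lemma primaryFactor_div_ne_zero {z : ℂ} (hz : z ∈ (L.lattice \ {0} : Set ℂ)ᶜ)
    (l : {l : L.lattice // l ≠ 0}) : primaryFactor (z / (l : ℂ)) ≠ 0 := by
  have hl : (l : ℂ) ≠ 0 := by simpa using l.2
  refine primaryFactor_ne_zero fun h ↦ hz ?_
  rw [div_eq_one_iff_eq hl] at h
  subst h
  exact ⟨l.1.2, hl⟩

lemma sigmaQuotient_ne_zero {z : ℂ} (hz : z ∈ (L.lattice \ {0} : Set ℂ)ᶜ) :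
    L.sigmaQuotient z ≠ 0 := by
  have hr : 0 < ‖z‖ + 1 := by positivity
  have h := tprod_one_add_ne_zero_of_summable
    (f := fun l : {l : L.lattice // l ≠ 0} ↦ primaryFactor (z / (l : ℂ)) - 1)
    (fun l ↦ by simpa using L.primaryFactor_div_ne_zero hz l)
    ((L.summable_norm_inv_pow_three.mul_left (12 * (‖z‖ + 1) ^ 3)).of_norm_bounded_eventually
      (by
        filter_upwards [L.eventually_cofinite_norm_primaryFactor_sub_one_le hr] with l hl
        simpa using hl z (by simp)))
  simpa only [add_sub_cancel] using! h

lemma sigmaQuotient_zero : L.sigmaQuotient 0 = 1 := by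
  simp [sigmaQuotient, primaryFactor]

lemma sigmaQuotient_neg (z : ℂ) : L.sigmaQuotient (-z) = L.sigmaQuotient z := by
  let e : {l : L.lattice // l ≠ 0} ≃ {l : L.lattice // l ≠ 0} :=
    (Equiv.neg L.lattice).subtypeEquiv fun l ↦ by simp
  simp only [sigmaQuotient]
  rw [← e.tprod_eq]
  congr! 2 with l
  simp [e, neg_div_neg_eq]

lemma weierstrassSigma_neg (z : ℂ) : L.weierstrassSigma (-z) = -L.weierstrassSigma z := by
  rw [weierstrassSigma_eq, weierstrassSigma_eq, sigmaQuotient_neg, neg_mul]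

lemma weierstrassSigma_ne_zero {z : ℂ} (hz : z ∉ L.lattice) : L.weierstrassSigma z ≠ 0 := by
  rw [weierstrassSigma_eq]
  refine mul_ne_zero ?_ (L.sigmaQuotient_ne_zero fun h ↦ hz h.1)
  rintro rfl
  exact hz (zero_mem _)

lemma weierstrassSigma_zero : L.weierstrassSigma 0 = 0 := by simp [weierstrassSigma_eq]

/-- The second logarithmic derivative of one factor of the `σ`-product is the corresponding
summand of `-℘`. -/
lemma deriv_logDeriv_primaryFactor_div {l z : ℂ} (hl : l ≠ 0) (hz : z ≠ l) :
    deriv (logDeriv fun w ↦ primaryFactor (w / l)) z = -(1 / (z - l) ^ 2 - 1 / l ^ 2) := by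
  have h : ∀ w, w ≠ l → logDeriv (fun w ↦ primaryFactor (w / l)) w =
      1 / (w - l) + 1 / l + w / l ^ 2 := by
    intro w hw
    have h1 : 1 - w / l ≠ 0 := by
      rw [sub_ne_zero, ne_comm, Ne, div_eq_one_iff_eq hl]; exact hw
    have h2 : w - l ≠ 0 := sub_ne_zero.mpr hw
    have h3 : HasDerivAt (fun w ↦ primaryFactor (w / l))
        ((-(1 / l)) * Complex.exp (w / l + (w / l) ^ 2 / 2) + (1 - w / l) *
          (Complex.exp (w / l + (w / l) ^ 2 / 2) * (1 / l + (2 * (w / l) * (1 / l)) / 2))) w := by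
      have h4 : HasDerivAt (fun w ↦ w / l) (1 / l) w := (hasDerivAt_id w).div_const l
      have h5 := (h4.add ((h4.pow 2).div_const 2)).cexp
      have := (h4.const_sub 1).mul h5
      simpa [primaryFactor] using! this
    rw [logDeriv_apply, h3.deriv, primaryFactor]
    have h6 := Complex.exp_ne_zero (w / l + (w / l) ^ 2 / 2)
    generalize Complex.exp (w / l + (w / l) ^ 2 / 2) = E at h6
    have h7 : l - w ≠ 0 := sub_ne_zero.mpr hw.symm
    rw [show 1 - w / l = (l - w) / l by field_simp]
    rw [show w - l = -(l - w) by ring]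
    field_simp
    ring
  have h0 : logDeriv (fun w ↦ primaryFactor (w / l)) =ᶠ[𝓝 z]
      fun w ↦ (w - l)⁻¹ + 1 / l + w / l ^ 2 := by
    filter_upwards [isOpen_ne.mem_nhds hz] with w hw
    rw [h w hw, one_div]
  have h2 : z - l ≠ 0 := sub_ne_zero.mpr hz
  have h3 : HasDerivAt (fun w ↦ (w - l)⁻¹ + 1 / l + w / l ^ 2) (-1 / (z - l) ^ 2 + 1 / l ^ 2) z :=
    ((((hasDerivAt_id z).sub_const l).inv h2).add_const _).add ((hasDerivAt_id z).div_const _)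
  rw [h0.deriv_eq, h3.deriv]
  ring

lemma deriv_logDeriv_eq {f : ℂ → ℂ} (hf : Differentiable ℂ f) {z : ℂ} (hz : f z ≠ 0) :
    deriv (logDeriv f) z = (deriv (deriv f) z * f z - deriv f z ^ 2) / f z ^ 2 := by
  have : logDeriv f = fun z ↦ deriv f z / f z := rfl
  rw [this, deriv_fun_div (hf.deriv z) (hf z) hz]
  ring

/-- The second logarithmic derivative of `σ(z) / z` is minus the regular part of `℘` at `0`. -/
lemma deriv_logDeriv_sigmaQuotient {z : ℂ} (hz : z ∈ (L.lattice \ {0} : Set ℂ)ᶜ) :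
    deriv (logDeriv L.sigmaQuotient) z = -L.weierstrassPExcept 0 z := by
  set U := Metric.ball (0 : ℂ) (‖z‖ + 1)
  have hU : IsOpen U := Metric.isOpen_ball
  have hzU : z ∈ U := by simp [U]
  have hd := fun s ↦ L.differentiable_finsetProd_primaryFactor s
  have t0 := L.tendstoLocallyUniformlyOn_sigmaQuotient (r := ‖z‖ + 1) (by positivity)
  have t1 := t0.deriv (.of_forall fun s ↦ (hd s).differentiableOn) hU
  have t2 := t1.deriv (.of_forall fun s ↦ (hd s).deriv.differentiableOn) hU
  have hlim := (((t2.tendsto_at hzU).mul (t0.tendsto_at hzU)).sub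
    ((t1.tendsto_at hzU).pow 2)).div ((t0.tendsto_at hzU).pow 2)
    (pow_ne_zero 2 (L.sigmaQuotient_ne_zero hz))
  rw [← deriv_logDeriv_eq L.differentiable_sigmaQuotient (L.sigmaQuotient_ne_zero hz)] at hlim
  have hne := L.primaryFactor_div_ne_zero hz
  have hsum : HasSum (fun l : {l : L.lattice // l ≠ 0} ↦
      1 / (z - (l : ℂ)) ^ 2 - 1 / (l : ℂ) ^ 2) (L.weierstrassPExcept 0 z) := by
    have h := L.hasSum_weierstrassPExcept 0 z
    rw [← hasSum_subtype_iff_of_support_subset (s := {l : L.lattice | l ≠ 0})] at h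
    · refine h.congr_fun fun l ↦ ?_
      have : ((l : L.lattice) : ℂ) ≠ 0 := fun h ↦ l.2 (Subtype.ext h)
      simp only [Function.comp_apply, if_neg this]
    · intro l hl h0
      simp [h0] at hl
  have hprod (s : Finset {l : L.lattice // l ≠ 0}) :
      ∏ l ∈ s, primaryFactor (z / (l : ℂ)) ≠ 0 := Finset.prod_ne_zero_iff.mpr fun l _ ↦ hne l
  refine tendsto_nhds_unique hlim ((hsum.neg : Tendsto _ _ _).congr fun s ↦ ?_)
  refine Eq.trans ?_ (deriv_logDeriv_eq (hd s) (hprod s))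
  have hev : logDeriv (fun w ↦ ∏ l ∈ s, primaryFactor (w / (l : ℂ))) =ᶠ[𝓝 z]
      fun w ↦ ∑ l ∈ s, logDeriv (fun w ↦ primaryFactor (w / (l : ℂ))) w := by
    filter_upwards [(L.isClosed_of_subset_lattice Set.sdiff_subset).isOpen_compl.mem_nhds hz]
      with w hw
    exact logDeriv_prod (fun l _ ↦ L.primaryFactor_div_ne_zero hw l) fun l _ ↦
      (differentiable_primaryFactor _).comp _ (by fun_prop)
  rw [hev.deriv_eq, deriv_fun_sum]
  · refine Finset.sum_congr rfl fun l _ ↦ ?_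
    have hl : (l : ℂ) ≠ 0 := by simpa using l.2
    rw [deriv_logDeriv_primaryFactor_div hl]
    rintro rfl
    exact hz ⟨l.1.2, hl⟩
  · intro l _
    have hf : Differentiable ℂ fun w ↦ primaryFactor (w / (l : ℂ)) :=
      differentiable_primaryFactor.comp (differentiable_id.div_const _)
    exact (hf.deriv z).div (hf z) (hne l)

/-! ### Quasi-periodicity of `σ` -/

lemma isOpen_compl_lattice : IsOpen ((L.lattice : Set ℂ)ᶜ) := L.isClosed_lattice.isOpen_compl

lemma isPreconnected_compl_lattice : IsPreconnected ((L.lattice : Set ℂ)ᶜ) :=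
  (Set.Countable.isConnected_compl_of_one_lt_rank (by simp [Complex.rank_real_complex])
    (countable_of_Lindelof_of_discrete (X := L.lattice))).isPreconnected

lemma weierstrassSigma_of_mem {z : ℂ} (hz : z ∈ L.lattice) : L.weierstrassSigma z = 0 := by
  rw [weierstrassSigma_eq]
  by_cases h0 : z = 0
  · simp [h0]
  · rw [sigmaQuotient, tprod_of_exists_eq_zero, mul_zero]
    exact ⟨⟨⟨z, hz⟩, fun h ↦ h0 (congrArg Subtype.val h)⟩, by simp [primaryFactor, h0]⟩

lemma mem_diff_zero_of_notMem {z : ℂ} (hz : z ∉ L.lattice) :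
    z ∈ (L.lattice \ {0} : Set ℂ)ᶜ := fun h ↦ hz h.1

lemma deriv_logDeriv_weierstrassSigma {z : ℂ} (hz : z ∉ L.lattice) :
    deriv (logDeriv L.weierstrassSigma) z = -L.weierstrassP z := by
  have hz0 : z ≠ 0 := by rintro rfl; exact hz (zero_mem _)
  have hev : logDeriv L.weierstrassSigma =ᶠ[𝓝 z] fun w ↦ w⁻¹ + logDeriv L.sigmaQuotient w := by
    filter_upwards [L.isOpen_compl_lattice.mem_nhds hz] with w hw
    have hw0 : w ≠ 0 := by rintro rfl; exact hw (zero_mem _)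
    rw [funext L.weierstrassSigma_eq, logDeriv_mul (f := fun w ↦ w) w hw0
      (L.sigmaQuotient_ne_zero (L.mem_diff_zero_of_notMem hw)) differentiableAt_id
      (L.differentiable_sigmaQuotient w), logDeriv_id', one_div]
  have hd := L.differentiable_sigmaQuotient
  have hne := L.sigmaQuotient_ne_zero (L.mem_diff_zero_of_notMem hz)
  rw [hev.deriv_eq, deriv_fun_add (g := logDeriv L.sigmaQuotient) (differentiableAt_inv hz0)
      ((hd.deriv z).div (hd z) hne),
    L.deriv_logDeriv_sigmaQuotient (L.mem_diff_zero_of_notMem hz), deriv_inv,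
    ← L.weierstrassPExcept_add 0]
  simp

/-- The quasi-periodicity of `σ`. The constant `C` is `exp (η l / 2)` up to sign, but only its
existence matters here. -/
lemma exists_weierstrassSigma_add (l : L.lattice) :
    ∃ C η : ℂ, C ≠ 0 ∧
      ∀ z, L.weierstrassSigma (z + l) = C * Complex.exp (η * z) * L.weierstrassSigma z := by
  have hd := L.differentiable_weierstrassSigma
  have hmem (z : ℂ) : z + l ∈ L.lattice ↔ z ∈ L.lattice :=
    L.lattice.toAddSubgroup.add_mem_cancel_right l.2
  set S : ℂ → ℂ := fun z ↦ L.weierstrassSigma (z + l) with hS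
  have hSd : Differentiable ℂ S := hd.comp (differentiable_id.add_const _)
  have hld (z : ℂ) : logDeriv S z = logDeriv L.weierstrassSigma (z + l) := by
    simp only [logDeriv_apply, hS, deriv_comp_add_const]
  have hlD (z : ℂ) (hz : z ∉ L.lattice) : DifferentiableAt ℂ (logDeriv L.weierstrassSigma) z :=
    (hd.deriv z).div (hd z) (L.weierstrassSigma_ne_zero hz)
  have hSD (z : ℂ) (hz : z ∉ L.lattice) : DifferentiableAt ℂ (logDeriv S) z :=
    (hSd.deriv z).div (hSd z) (L.weierstrassSigma_ne_zero (by rwa [hmem]))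
  obtain ⟨η, hη⟩ := L.isOpen_compl_lattice.exists_is_const_of_deriv_eq_zero
    (f := fun z ↦ logDeriv S z - logDeriv L.weierstrassSigma z)
    L.isPreconnected_compl_lattice
    (fun z hz ↦ ((hSD z hz).sub (hlD z hz)).differentiableWithinAt) (fun z hz ↦ by
      have hz : z ∉ L.lattice := hz
      rw [deriv_fun_sub (hSD z hz) (hlD z hz), funext hld, deriv_comp_add_const,
        L.deriv_logDeriv_weierstrassSigma hz,
        L.deriv_logDeriv_weierstrassSigma (by rwa [hmem]), L.weierstrassP_add_coe]
      simp)
  have hexp : Differentiable ℂ fun z ↦ Complex.exp (η * z) := by fun_prop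
  obtain ⟨C, hC, hCe⟩ := (logDeriv_eqOn_iff (f := S)
    (g := fun z ↦ Complex.exp (η * z) * L.weierstrassSigma z) (s := (L.lattice : Set ℂ)ᶜ)
    hSd.differentiableOn (hexp.mul hd).differentiableOn L.isOpen_compl_lattice
    L.isPreconnected_compl_lattice
    (fun z hz ↦ mul_ne_zero (Complex.exp_ne_zero _) (L.weierstrassSigma_ne_zero hz))
    (fun z hz ↦ L.weierstrassSigma_ne_zero (by rwa [hmem]))).mp (fun z hz ↦ by
      have h1 := hη z hz
      have h2 : logDeriv (fun z ↦ Complex.exp (η * z)) z = η := by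
        have : HasDerivAt (fun z ↦ Complex.exp (η * z)) (Complex.exp (η * z) * η) z := by
          simpa using ((hasDerivAt_id z).const_mul η).cexp
        rw [logDeriv_apply, this.deriv, mul_div_cancel_left₀ _ (Complex.exp_ne_zero _)]
      rw [logDeriv_mul (f := fun z ↦ Complex.exp (η * z)) z (Complex.exp_ne_zero _)
        (L.weierstrassSigma_ne_zero hz) (hexp z) (hd z),
        h2, ← h1]
      ring)
  refine ⟨C, η, hC, fun z ↦ ?_⟩
  by_cases hz : z ∈ L.lattice
  · rw [L.weierstrassSigma_of_mem hz, L.weierstrassSigma_of_mem ((hmem z).mpr hz), mul_zero]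
  · have := hCe hz
    simpa [hS, mul_assoc] using this

/-! ### Elliptic functions with poles only at the lattice points -/

/-- A lattice-periodic function, holomorphic away from the lattice, which agrees near `0` with the
quotient `q(z) / zⁿ` for some `q` analytic at `0`: an elliptic function whose only poles are the
lattice points, of order at most `n`. The values at the lattice points are irrelevant. -/
structure IsEllipticWithPole (n : ℕ) (f : ℂ → ℂ) : Prop where
  differentiableAt : ∀ z ∉ L.lattice, DifferentiableAt ℂ f z
  periodic : ∀ z ∉ L.lattice, ∀ l : L.lattice, f (z + l) = f z
  exists_analyticAt : ∃ q : ℂ → ℂ, AnalyticAt ℂ q 0 ∧ ∀ᶠ z in 𝓝[≠] 0, f z = q z / z ^ n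

variable {L}

lemma tendsto_neg_nhdsNE_zero : Tendsto (fun z : ℂ ↦ -z) (𝓝[≠] 0) (𝓝[≠] 0) := by
  refine tendsto_nhdsWithin_of_tendsto_nhds_of_eventually_within _
    (tendsto_nhdsWithin_of_tendsto_nhds (by simpa using (continuous_neg (G := ℂ)).tendsto 0)) ?_
  filter_upwards [self_mem_nhdsWithin] with z hz
  simpa using hz

lemma eventually_add_notMem_lattice (x : ℂ) : ∀ᶠ z in 𝓝[≠] (0 : ℂ), z + x ∉ L.lattice := by
  have h : Tendsto (fun z ↦ z + x) (𝓝[≠] 0) (𝓝 x) :=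
    tendsto_nhdsWithin_of_tendsto_nhds (by simpa using (continuous_add_const x).tendsto 0)
  filter_upwards [h (L.compl_lattice_sdiff_singleton_mem_nhds x), self_mem_nhdsWithin]
    with z hz hz0 hzL
  exact hz ⟨hzL, by simpa using hz0⟩

lemma eventually_notMem_lattice : ∀ᶠ z in 𝓝[≠] (0 : ℂ), z ∉ L.lattice := by
  simpa using eventually_add_notMem_lattice (L := L) 0

/-- Liouville's theorem: an elliptic function without poles is constant. -/
lemma IsEllipticWithPole.exists_const {f : ℂ → ℂ} (hf : L.IsEllipticWithPole 0 f) :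
    ∃ c, ∀ z ∉ L.lattice, f z = c := by
  classical
  obtain ⟨q, hq, hfq⟩ := hf.exists_analyticAt
  let g : ℂ → ℂ := fun z ↦ if z ∈ L.lattice then q 0 else f z
  have hmem (z : ℂ) (l : L.lattice) : z + l ∈ L.lattice ↔ z ∈ L.lattice :=
    L.lattice.toAddSubgroup.add_mem_cancel_right l.2
  have hper (z : ℂ) (l : L.lattice) : g (z + l) = g z := by
    by_cases hz : z ∈ L.lattice
    · simp [g, hmem, hz]
    · simp [g, hmem, hz, hf.periodic z hz l]
  have h0 : DifferentiableAt ℂ g 0 := by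
    refine hq.differentiableAt.congr_of_eventuallyEq ?_
    have : ∀ᶠ z in 𝓝[≠] 0, g z = q z := by
      filter_upwards [hfq, eventually_notMem_lattice (L := L)] with z hz hzL
      simp [g, hzL, hz]
    rw [eventually_nhdsWithin_iff] at this
    filter_upwards [this] with z hz
    by_cases h : z = 0
    · simp [h, g]
    · exact hz h
  have hg : Differentiable ℂ g := by
    intro z
    by_cases hz : z ∈ L.lattice
    · have h1 : DifferentiableAt ℂ (fun w ↦ g (w - z)) z := by
        have h2 : DifferentiableAt ℂ g (z - z) := by rwa [sub_self]
        exact h2.comp (f := fun w ↦ w - z) z (differentiableAt_id.sub_const z)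
      convert! h1 using 1
      ext w
      simpa using hper (w - z) ⟨z, hz⟩
    · refine (hf.differentiableAt z hz).congr_of_eventuallyEq ?_
      filter_upwards [L.isOpen_compl_lattice.mem_nhds hz] with w hw
      exact if_neg hw
  refine ⟨g 0, fun z hz ↦ ?_⟩
  rw [← hg.apply_eq_apply_of_bounded (IsZLattice.isCompact_range_of_periodic L.lattice _
    hg.continuous fun z w hw ↦ hper z ⟨w, hw⟩).isBounded z 0]
  simp [g, hz]

namespace IsEllipticWithPole

variable {f g : ℂ → ℂ} {m n : ℕ}

lemma add (hf : L.IsEllipticWithPole n f) (hg : L.IsEllipticWithPole n g) :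
    L.IsEllipticWithPole n fun z ↦ f z + g z := by
  obtain ⟨p, hp, hfp⟩ := hf.exists_analyticAt
  obtain ⟨q, hq, hgq⟩ := hg.exists_analyticAt
  refine ⟨fun z hz ↦ (hf.differentiableAt z hz).add (hg.differentiableAt z hz),
    fun z hz l ↦ by rw [hf.periodic z hz, hg.periodic z hz], _, hp.add hq, ?_⟩
  filter_upwards [hfp, hgq] with z h1 h2
  rw [h1, h2, Pi.add_apply, add_div]

lemma mul (hf : L.IsEllipticWithPole m f) (hg : L.IsEllipticWithPole n g) :
    L.IsEllipticWithPole (m + n) fun z ↦ f z * g z := by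
  obtain ⟨p, hp, hfp⟩ := hf.exists_analyticAt
  obtain ⟨q, hq, hgq⟩ := hg.exists_analyticAt
  refine ⟨fun z hz ↦ (hf.differentiableAt z hz).mul (hg.differentiableAt z hz),
    fun z hz l ↦ by rw [hf.periodic z hz, hg.periodic z hz], _, hp.mul hq, ?_⟩
  filter_upwards [hfp, hgq] with z h1 h2
  rw [h1, h2, Pi.mul_apply, pow_add, div_mul_div_comm]

lemma const (c : ℂ) : L.IsEllipticWithPole 0 fun _ ↦ c :=
  ⟨fun _ _ ↦ differentiableAt_const _, fun _ _ _ ↦ rfl, fun _ ↦ c, analyticAt_const,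
    .of_forall fun _ ↦ by simp⟩

lemma const_mul (c : ℂ) (hf : L.IsEllipticWithPole n f) :
    L.IsEllipticWithPole n fun z ↦ c * f z := by
  simpa using (const c).mul hf

lemma comp_neg (hf : L.IsEllipticWithPole n f) : L.IsEllipticWithPole n fun z ↦ f (-z) := by
  obtain ⟨q, hq, hfq⟩ := hf.exists_analyticAt
  refine ⟨fun z hz ↦ ?_, fun z hz l ↦ ?_, fun z ↦ (-1) ^ n * q (-z), ?_, ?_⟩
  · exact (hf.differentiableAt (-z) (by simpa using hz)).comp z differentiableAt_id.neg
  · simpa [neg_add, add_comm] using hf.periodic (-z) (by simpa using hz) (-l)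
  · refine analyticAt_const.mul (AnalyticAt.fun_comp_of_eq hq analyticAt_id.neg (by simp))
  · have h : Tendsto (fun z : ℂ ↦ -z) (𝓝[≠] 0) (𝓝[≠] 0) := tendsto_neg_nhdsNE_zero
    filter_upwards [h.eventually hfq, self_mem_nhdsWithin] with z hz hz0
    have hz0 : z ≠ 0 := hz0
    rw [hz, neg_pow z]
    have h1 : ((-1 : ℂ) ^ n) * (-1) ^ n = 1 := by rw [← mul_pow]; simp
    have h2 : (-1 : ℂ) ^ n ≠ 0 := pow_ne_zero _ (by norm_num)
    field_simp
    linear_combination -q (-z) * h1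

/-- The order of the pole drops when the leading coefficient vanishes. -/
lemma of_leading_coeff_eq_zero {q : ℂ → ℂ} (hf : L.IsEllipticWithPole (n + 1) f)
    (hq : AnalyticAt ℂ q 0) (hfq : ∀ᶠ z in 𝓝[≠] 0, f z = q z / z ^ (n + 1)) (h0 : q 0 = 0) :
    L.IsEllipticWithPole n f := by
  refine ⟨hf.differentiableAt, hf.periodic, dslope q 0, ?_, ?_⟩
  · obtain ⟨p, hp⟩ := hq
    exact ⟨_, hp.has_fpower_series_dslope_fslope⟩
  · filter_upwards [hfq, self_mem_nhdsWithin] with z hz hz0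
    have hz0 : z ≠ 0 := hz0
    rw [hz, dslope_of_ne _ hz0, slope_def_field, h0]
    field_simp
    ring

/-- The leading coefficient vanishes when the parity of the function and the order of its pole
disagree. -/
lemma leading_coeff_eq_zero_of_parity {q : ℂ → ℂ} {ε : ℂ} (hε : ε * (-1) ^ n = -1)
    (hq : AnalyticAt ℂ q 0) (hfq : ∀ᶠ z in 𝓝[≠] 0, f z = q z / z ^ n)
    (hf : ∀ z ∉ L.lattice, f (-z) = ε * f z) : q 0 = 0 := by
  have hneg : Tendsto (fun z : ℂ ↦ -z) (𝓝[≠] 0) (𝓝[≠] 0) := tendsto_neg_nhdsNE_zero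
  have hlim : Tendsto q (𝓝[≠] 0) (𝓝 (q 0)) := hq.continuousAt.tendsto.mono_left nhdsWithin_le_nhds
  have hlim' : Tendsto (fun z ↦ -q (-z)) (𝓝[≠] 0) (𝓝 (-q 0)) := (hlim.comp hneg).neg
  have heq : q =ᶠ[𝓝[≠] 0] fun z ↦ -q (-z) := by
    filter_upwards [hfq, hneg.eventually hfq, self_mem_nhdsWithin,
      eventually_notMem_lattice (L := L)] with z h1 h2 hz0 hzL
    have hz0 : z ≠ 0 := hz0
    rw [hf z hzL, h1, neg_pow z] at h2
    have h3 : ((-1 : ℂ) ^ n) ≠ 0 := pow_ne_zero _ (by norm_num)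
    field_simp at h2
    linear_combination -h2 + q z * hε
  have h := tendsto_nhds_unique (hlim.congr' heq) hlim'
  linear_combination h / 2

end IsEllipticWithPole

variable (L)

lemma exists_weierstrassP_eq : ∃ q : ℂ → ℂ, AnalyticAt ℂ q 0 ∧ q 0 = 1 ∧
    ∀ᶠ z in 𝓝[≠] 0, L.weierstrassP z = q z / z ^ 2 := by
  refine ⟨fun z ↦ 1 + z ^ 2 * L.weierstrassPExcept 0 z, ?_, by simp, ?_⟩
  · have := L.analyticAt_weierstrassPExcept 0
    fun_prop
  · filter_upwards [self_mem_nhdsWithin] with z hz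
    have hz : z ≠ 0 := hz
    have := L.weierstrassPExcept_add 0 z
    simp only [ZeroMemClass.coe_zero] at this
    rw [← this]
    field_simp
    simp [add_comm]

lemma exists_derivWeierstrassP_eq : ∃ q : ℂ → ℂ, AnalyticAt ℂ q 0 ∧ q 0 = -2 ∧
    ∀ᶠ z in 𝓝[≠] 0, L.derivWeierstrassP z = q z / z ^ 3 := by
  refine ⟨fun z ↦ -2 + z ^ 3 * L.derivWeierstrassPExcept 0 z, ?_, by simp, ?_⟩
  · have := L.analyticAt_derivWeierstrassPExcept 0
    fun_prop
  · filter_upwards [self_mem_nhdsWithin] with z hz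
    have hz : z ≠ 0 := hz
    have := L.derivWeierstrassPExcept_sub 0 z
    simp only [ZeroMemClass.coe_zero] at this
    rw [← this]
    field_simp
    simp [hz]
    ring

lemma isEllipticWithPole_weierstrassP : L.IsEllipticWithPole 2 L.weierstrassP := by
  obtain ⟨q, hq, -, h⟩ := L.exists_weierstrassP_eq
  exact ⟨fun z hz ↦ L.differentiableOn_weierstrassP.differentiableAt
    (L.isOpen_compl_lattice.mem_nhds hz), fun z _ l ↦ L.weierstrassP_add_coe z l, q, hq, h⟩

lemma isEllipticWithPole_derivWeierstrassP : L.IsEllipticWithPole 3 L.derivWeierstrassP := by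
  obtain ⟨q, hq, -, h⟩ := L.exists_derivWeierstrassP_eq
  exact ⟨fun z hz ↦ L.differentiableOn_derivWeierstrassP.differentiableAt
    (L.isOpen_compl_lattice.mem_nhds hz), fun z _ l ↦ L.derivWeierstrassP_add_coe z l, q, hq, h⟩

/-- A function with the same automorphy factor as `σⁿ`, divided by `σⁿ`. -/
lemma isEllipticWithPole_div_weierstrassSigma_pow {M : ℂ → ℂ} {n : ℕ} (hM : Differentiable ℂ M)
    (h : ∀ (l : L.lattice) (C η : ℂ),
      (∀ z, L.weierstrassSigma (z + l) = C * Complex.exp (η * z) * L.weierstrassSigma z) →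
      ∀ z, M (z + l) = (C * Complex.exp (η * z)) ^ n * M z) :
    L.IsEllipticWithPole n fun z ↦ M z / L.weierstrassSigma z ^ n := by
  refine ⟨fun z hz ↦ (hM z).div ((L.differentiable_weierstrassSigma z).pow n)
    (pow_ne_zero _ (L.weierstrassSigma_ne_zero hz)), fun z hz l ↦ ?_,
    fun z ↦ M z / L.sigmaQuotient z ^ n, ?_, ?_⟩
  · obtain ⟨C, η, hC, hσ⟩ := L.exists_weierstrassSigma_add l
    rw [h l C η hσ, hσ, mul_pow (C * Complex.exp (η * z)), mul_div_mul_left]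
    exact pow_ne_zero _ (mul_ne_zero hC (Complex.exp_ne_zero _))
  · exact (hM.analyticAt 0).div ((L.differentiable_sigmaQuotient.analyticAt 0).pow n)
      (by simp [sigmaQuotient_zero])
  · filter_upwards with z
    rw [weierstrassSigma_eq, mul_pow, div_div, mul_comm (z ^ n)]

variable {L}

namespace IsEllipticWithPole

variable {f : ℂ → ℂ}

/-- An even elliptic function with at most double poles, at the lattice points, is affine in `℘`. -/
lemma exists_eq_weierstrassP (hf : L.IsEllipticWithPole 2 f)
    (heven : ∀ z ∉ L.lattice, f (-z) = f z) :
    ∃ k c, ∀ z ∉ L.lattice, f z = k * L.weierstrassP z + c := by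
  obtain ⟨q, hq, hfq⟩ := hf.exists_analyticAt
  obtain ⟨p, hp, hp0, hPp⟩ := L.exists_weierstrassP_eq
  have h1 := (hf.add (L.isEllipticWithPole_weierstrassP.const_mul (-q 0))).of_leading_coeff_eq_zero
    (q := fun z ↦ q z - q 0 * p z) (by fun_prop)
    (by filter_upwards [hfq, hPp] with z h1 h2; rw [h1, h2]; ring) (by simp [hp0])
  obtain ⟨r, hr, hfr⟩ := h1.exists_analyticAt
  have h0 := h1.of_leading_coeff_eq_zero hr hfr
    (leading_coeff_eq_zero_of_parity (L := L) (ε := 1) (by simp) hr hfr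
      fun z hz ↦ by simp [heven z hz])
  obtain ⟨c, hc⟩ := h0.exists_const
  exact ⟨q 0, c, fun z hz ↦ by linear_combination hc z hz⟩

end IsEllipticWithPole

variable (L)

/-- The factorisation of `℘(u) - ℘(v)` in terms of `σ`. The constant is `-σ(v)²`, but it
suffices that it is nonzero. -/
lemma exists_weierstrassSigma_add_mul_sub {v : ℂ} (hv : v ∉ L.lattice) :
    ∃ k : ℂ, k ≠ 0 ∧ ∀ u ∉ L.lattice, L.weierstrassSigma (u + v) * L.weierstrassSigma (u - v) =
      k * L.weierstrassSigma u ^ 2 * (L.weierstrassP u - L.weierstrassP v) := by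
  have hd := L.differentiable_weierstrassSigma
  have hell := L.isEllipticWithPole_div_weierstrassSigma_pow (n := 2)
    (M := fun u ↦ L.weierstrassSigma (u + v) * L.weierstrassSigma (u - v))
    ((hd.comp (differentiable_id.add_const v)).mul (hd.comp (differentiable_id.sub_const v)))
    (fun l C η h z ↦ by
      rw [show z + l + v = z + v + l by ring, show z + l - v = z - v + l by ring, h, h, mul_pow,
        ← Complex.exp_nat_mul,
        show ((2 : ℕ) : ℂ) * (η * z) = η * (z + v) + η * (z - v) by push_cast; ring,
        Complex.exp_add]
      ring)
  obtain ⟨k, c, hk⟩ := hell.exists_eq_weierstrassP fun z _ ↦ by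
    rw [show -z + v = -(z - v) by ring, show -z - v = -(z + v) by ring]
    simp only [weierstrassSigma_neg]
    ring
  have hc : c = -k * L.weierstrassP v := by
    have := hk v hv
    simp only [sub_self, weierstrassSigma_zero, mul_zero, zero_div] at this
    linear_combination -this
  have hmain (u : ℂ) (hu : u ∉ L.lattice) : L.weierstrassSigma (u + v) * L.weierstrassSigma (u - v)
      = k * L.weierstrassSigma u ^ 2 * (L.weierstrassP u - L.weierstrassP v) := by
    have h1 := hk u hu
    have h2 := L.weierstrassSigma_ne_zero hu
    rw [div_eq_iff (pow_ne_zero 2 h2), hc] at h1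
    rw [h1]; ring
  refine ⟨k, ?_, hmain⟩
  rintro rfl
  -- `σ` does not vanish identically near `v`, so the left-hand side is not identically zero
  have hev : ∀ᶠ w in 𝓝[≠] (0 : ℂ), w + v ∉ L.lattice ∧ w + v + v ∉ L.lattice ∧ w ∉ L.lattice := by
    simpa only [add_assoc] using (eventually_add_notMem_lattice v).and
      ((eventually_add_notMem_lattice (v + v)).and eventually_notMem_lattice)
  obtain ⟨w, h1, h2, h3⟩ := hev.exists
  have := hmain (w + v) h1
  rw [zero_mul, zero_mul, add_sub_cancel_right] at this
  exact mul_ne_zero (L.weierstrassSigma_ne_zero h2) (L.weierstrassSigma_ne_zero h3) this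

lemma weierstrassP_eq_iff {u v : ℂ} (hu : u ∉ L.lattice) (hv : v ∉ L.lattice) :
    L.weierstrassP u = L.weierstrassP v ↔ u + v ∈ L.lattice ∨ u - v ∈ L.lattice := by
  constructor
  · intro h
    obtain ⟨k, -, hk⟩ := L.exists_weierstrassSigma_add_mul_sub hv
    have := hk u hu
    rw [h, sub_self, mul_zero, mul_eq_zero] at this
    by_contra! hc
    exact this.elim (L.weierstrassSigma_ne_zero hc.1) (L.weierstrassSigma_ne_zero hc.2)
  · rintro (h | h)
    · simpa using! L.weierstrassP_add_coe (-v) ⟨u + v, h⟩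
    · simpa using! L.weierstrassP_add_coe v ⟨u - v, h⟩

variable {L}

namespace IsEllipticWithPole

variable {f : ℂ → ℂ}

lemma eq_zero_of_odd_at_half_period (hf : ∀ z ∉ L.lattice, ∀ l : L.lattice, f (z + l) = f z)
    (hodd : ∀ z ∉ L.lattice, f (-z) = -f z) {w : ℂ} (hw : w ∉ L.lattice)
    (h2w : 2 * w ∈ L.lattice) : f w = 0 := by
  have h1 := hf (-w) (by simpa using hw) ⟨2 * w, h2w⟩
  rw [hodd w hw] at h1
  have h3 : -w + 2 * w = w := by ring
  simp only [h3] at h1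
  linear_combination h1 / 2

/-- There is no nonzero odd elliptic function with at most simple poles, at the lattice points.
Its square would be affine in `℘` and vanish at the half-periods `ω₁ / 2` and `ω₂ / 2`, at which
`℘` has different values. -/
lemma eq_zero_of_odd (hf : L.IsEllipticWithPole 1 f) (hodd : ∀ z ∉ L.lattice, f (-z) = -f z) :
    ∀ z ∉ L.lattice, f z = 0 := by
  obtain ⟨k, c, hk⟩ := (hf.mul hf).exists_eq_weierstrassP fun z hz ↦ by rw [hodd z hz]; ring
  have hw₁ := L.ω₁_div_two_notMem_lattice
  have hw₂ := L.ω₂_div_two_notMem_lattice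
  have h1 := hk _ hw₁
  have h2 := hk _ hw₂
  have hl₁ : 2 * (L.ω₁ / 2) ∈ L.lattice := by
    rw [mul_div_cancel₀ _ two_ne_zero]; exact L.ω₁_mem_lattice
  have hl₂ : 2 * (L.ω₂ / 2) ∈ L.lattice := by
    rw [mul_div_cancel₀ _ two_ne_zero]; exact L.ω₂_mem_lattice
  rw [eq_zero_of_odd_at_half_period hf.periodic hodd hw₁ hl₁, mul_zero] at h1
  rw [eq_zero_of_odd_at_half_period hf.periodic hodd hw₂ hl₂, mul_zero] at h2
  have hne : L.weierstrassP (L.ω₁ / 2) ≠ L.weierstrassP (L.ω₂ / 2) := by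
    rw [Ne, L.weierstrassP_eq_iff hw₁ hw₂, not_or]
    constructor
    · simpa [inv_mul_eq_div] using
        (L.mul_ω₁_add_mul_ω₂_mem_lattice (α := 1 / 2) (β := 1 / 2)).not.mpr (by norm_num)
    · simpa [inv_mul_eq_div, sub_eq_add_neg, neg_div] using
        (L.mul_ω₁_add_mul_ω₂_mem_lattice (α := 1 / 2) (β := -1 / 2)).not.mpr (by norm_num)
  have hk0 : k = 0 := by
    have : k * (L.weierstrassP (L.ω₁ / 2) - L.weierstrassP (L.ω₂ / 2)) = 0 := by
      linear_combination h2 - h1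
    exact (mul_eq_zero.mp this).resolve_right (sub_ne_zero.mpr hne)
  intro z hz
  have h := hk z hz
  rw [hk0] at h h1
  exact mul_self_eq_zero.mp (by linear_combination h - h1)

/-- The space of elliptic functions with at most triple poles, at the lattice points, is spanned
by `℘'`, `℘` and `1`. -/
lemma exists_eq_derivWeierstrassP (hf : L.IsEllipticWithPole 3 f) :
    ∃ k₁ k₂ k₃, ∀ z ∉ L.lattice,
      f z = k₁ * L.derivWeierstrassP z + k₂ * L.weierstrassP z + k₃ := by
  have hneg {z : ℂ} (hz : z ∉ L.lattice) : -z ∉ L.lattice := by simpa using hz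
  -- the even part has a pole of order two
  have he := hf.add hf.comp_neg
  obtain ⟨q, hq, hfq⟩ := he.exists_analyticAt
  obtain ⟨k₂, k₃, hk⟩ := (he.of_leading_coeff_eq_zero hq hfq
    (leading_coeff_eq_zero_of_parity (L := L) (ε := 1) (by norm_num) hq hfq
      fun z _ ↦ by simp [add_comm])).exists_eq_weierstrassP fun z _ ↦ by simp [add_comm]
  -- a multiple of `℘'` cancels the triple pole of the odd part, and then its poles are simple
  have ho := hf.add (hf.comp_neg.const_mul (-1))
  obtain ⟨r, hr, hfr⟩ := ho.exists_analyticAt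
  obtain ⟨p, hp, hp0, hPp⟩ := L.exists_derivWeierstrassP_eq
  have h2 := (ho.add
    (L.isEllipticWithPole_derivWeierstrassP.const_mul (r 0 / 2))).of_leading_coeff_eq_zero
    (q := fun z ↦ r z + r 0 / 2 * p z) (by fun_prop)
    (by filter_upwards [hfr, hPp] with z h1 h2; rw [h1, h2]; ring) (by simp [hp0])
  have hodd : ∀ z ∉ L.lattice, f (-z) + -1 * f (- -z) + r 0 / 2 * L.derivWeierstrassP (-z) =
      -(f z + -1 * f (-z) + r 0 / 2 * L.derivWeierstrassP z) := fun z _ ↦ by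
    rw [neg_neg, derivWeierstrassP_neg]; ring
  obtain ⟨s, hs, hfs⟩ := h2.exists_analyticAt
  have h0 := (h2.of_leading_coeff_eq_zero hs hfs
    (leading_coeff_eq_zero_of_parity (L := L) (ε := -1) (by norm_num) hs hfs
      fun z hz ↦ by rw [hodd z hz]; ring)).eq_zero_of_odd hodd
  refine ⟨-r 0 / 4, k₂ / 2, k₃ / 2, fun z hz ↦ ?_⟩
  linear_combination (hk z hz + h0 z hz) / 2

end IsEllipticWithPole

/-! ### Collinear points and the addition theorem -/

/-- `℘` takes infinitely many values, so a polynomial identity in `℘` is an identity of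
polynomials. -/
lemma polynomial_eq_zero_of_forall_eval_weierstrassP {f : Polynomial ℂ}
    (hf : ∀ z ∉ L.lattice, f.eval (L.weierstrassP z) = 0) : f = 0 := by
  refine Polynomial.eq_zero_of_infinite_isRoot f (Set.Infinite.mono
    (s := L.weierstrassP '' (L.lattice : Set ℂ)ᶜ) ?_ fun hfin ↦ ?_)
  · rintro _ ⟨z, hz, rfl⟩
    exact hf z hz
  · obtain ⟨M, hM⟩ := hfin.isBounded.exists_norm_le
    obtain ⟨q, hq, hq1, hPq⟩ := L.exists_weierstrassP_eq
    have h1 : Tendsto q (𝓝[≠] 0) (𝓝 1) :=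
      hq1 ▸ hq.continuousAt.tendsto.mono_left nhdsWithin_le_nhds
    have h2 : Tendsto q (𝓝[≠] 0) (𝓝 0) := by
      refine squeeze_zero_norm' (a := fun z ↦ M * ‖z‖ ^ 2) ?_ ?_
      · filter_upwards [hPq, eventually_notMem_lattice (L := L), self_mem_nhdsWithin]
          with z h3 hz hz0
        have hz0 : z ≠ 0 := hz0
        rw [eq_div_iff (pow_ne_zero 2 hz0)] at h3
        rw [← h3, norm_mul, norm_pow]
        gcongr
        exact hM _ ⟨z, hz, rfl⟩
      · refine tendsto_nhdsWithin_of_tendsto_nhds ?_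
        have : Continuous fun z : ℂ ↦ M * ‖z‖ ^ 2 := by fun_prop
        simpa using this.tendsto 0
    exact one_ne_zero (tendsto_nhds_unique h1 h2)

/-- The function `σ(z - α) σ(z + β) σ(z + α - β) / σ(z)³` is, up to a nonzero constant, the line
through the points of the Weierstrass curve with parameters `α` and `-β`. -/
lemma exists_weierstrassSigma_mul_eq_line {α β : ℂ} (hα : α ∉ L.lattice) (hβ : β ∉ L.lattice)
    {m n : ℂ} (hab : L.weierstrassP α ≠ L.weierstrassP β)
    (hA : L.derivWeierstrassP α = m * L.weierstrassP α + n)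
    (hB : -L.derivWeierstrassP β = m * L.weierstrassP β + n) :
    ∃ k : ℂ, k ≠ 0 ∧ ∀ z ∉ L.lattice,
      L.weierstrassSigma (z - α) * L.weierstrassSigma (z + β) * L.weierstrassSigma (z + α - β) =
        k * L.weierstrassSigma z ^ 3 *
          (L.derivWeierstrassP z - (m * L.weierstrassP z + n)) := by
  have hd := L.differentiable_weierstrassSigma
  obtain ⟨k₁, k₂, k₃, hk⟩ := (L.isEllipticWithPole_div_weierstrassSigma_pow (n := 3)
    (M := fun z ↦ L.weierstrassSigma (z - α) * L.weierstrassSigma (z + β) *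
      L.weierstrassSigma (z + α - β))
    (((hd.comp (differentiable_id.sub_const α)).mul (hd.comp (differentiable_id.add_const β))).mul
      (hd.comp ((differentiable_id.add_const α).sub_const β)))
    (fun l C η h z ↦ by
      rw [show z + l - α = z - α + l by ring, show z + l + β = z + β + l by ring,
        show z + l + α - β = z + α - β + l by ring, h, h, h, mul_pow, ← Complex.exp_nat_mul,
        show ((3 : ℕ) : ℂ) * (η * z) = η * (z - α) + η * (z + β) + η * (z + α - β) by
          push_cast; ring, Complex.exp_add, Complex.exp_add]
      ring)).exists_eq_derivWeierstrassP
  have h1 := hk α hα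
  have h2 := hk (-β) (by simpa using hβ)
  simp only [sub_self, neg_add_cancel, weierstrassSigma_zero, mul_zero, zero_mul, zero_div,
    weierstrassP_neg, derivWeierstrassP_neg] at h1 h2
  rw [hA] at h1
  rw [hB] at h2
  have hk₂ : k₂ = -k₁ * m := by
    refine mul_right_cancel₀ (sub_ne_zero.mpr hab) ?_
    linear_combination h2 - h1
  have hk₃ : k₃ = -k₁ * n := by
    rw [hk₂] at h1
    linear_combination -h1
  have hmain (z : ℂ) (hz : z ∉ L.lattice) :
      L.weierstrassSigma (z - α) * L.weierstrassSigma (z + β) * L.weierstrassSigma (z + α - β) =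
        k₁ * L.weierstrassSigma z ^ 3 *
          (L.derivWeierstrassP z - (m * L.weierstrassP z + n)) := by
    have h := hk z hz
    rw [div_eq_iff (pow_ne_zero 3 (L.weierstrassSigma_ne_zero hz)), hk₂, hk₃] at h
    rw [h]; ring
  refine ⟨k₁, ?_, hmain⟩
  rintro rfl
  obtain ⟨w, h0, h1, h2, h3⟩ := (eventually_notMem_lattice.and
    ((eventually_add_notMem_lattice (L := L) (-α)).and ((eventually_add_notMem_lattice β).and
      (eventually_add_notMem_lattice (α - β))))).exists
  have := hmain w h0
  rw [zero_mul, zero_mul, sub_eq_add_neg w α, add_sub_assoc] at this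
  exact mul_ne_zero (mul_ne_zero (L.weierstrassSigma_ne_zero h1) (L.weierstrassSigma_ne_zero h2))
    (L.weierstrassSigma_ne_zero h3) this

/-- The line `y = m x + n` through the points of the Weierstrass curve with parameters `α` and `-β`
meets the curve again at the point with parameter `β - α`. The last clause is Vieta's formula for
the quadratic coefficient of the cubic `4 (x - a) (x - b) (x - c)` of the preceding one. -/
lemma weierstrassP_collinear {α β : ℂ} (hα : α ∉ L.lattice) (hβ : β ∉ L.lattice)
    (hγ : β - α ∉ L.lattice) {m n : ℂ} (hab : L.weierstrassP α ≠ L.weierstrassP β)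
    (hA : L.derivWeierstrassP α = m * L.weierstrassP α + n)
    (hB : -L.derivWeierstrassP β = m * L.weierstrassP β + n) :
    L.derivWeierstrassP (β - α) = m * L.weierstrassP (β - α) + n ∧
    (∀ z ∉ L.lattice, L.derivWeierstrassP z ^ 2 = (m * L.weierstrassP z + n) ^ 2 +
      4 * (L.weierstrassP z - L.weierstrassP α) * (L.weierstrassP z - L.weierstrassP β) *
        (L.weierstrassP z - L.weierstrassP (β - α))) ∧
    L.weierstrassP α + L.weierstrassP β + L.weierstrassP (β - α) = m ^ 2 / 4 := by
  obtain ⟨k, hk0, hk⟩ := L.exists_weierstrassSigma_mul_eq_line hα hβ hab hA hB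
  obtain ⟨k₁, -, h₁⟩ := L.exists_weierstrassSigma_add_mul_sub hα
  obtain ⟨k₂, -, h₂⟩ := L.exists_weierstrassSigma_add_mul_sub hβ
  obtain ⟨k₃, -, h₃⟩ := L.exists_weierstrassSigma_add_mul_sub hγ
  have hC : L.derivWeierstrassP (β - α) = m * L.weierstrassP (β - α) + n := by
    have h := hk _ hγ
    rw [show β - α + α - β = 0 by ring, weierstrassSigma_zero, mul_zero, eq_comm, mul_eq_zero] at h
    exact sub_eq_zero.mp (h.resolve_left
      (mul_ne_zero hk0 (pow_ne_zero 3 (L.weierstrassSigma_ne_zero hγ))))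
  set a := L.weierstrassP α
  set b := L.weierstrassP β
  set c := L.weierstrassP (β - α)
  set K := -(k₁ * k₂ * k₃ / k ^ 2) with hK
  -- multiply the values of the line at `z` and at `-z`
  have hcub (z : ℂ) (hz : z ∉ L.lattice) : L.derivWeierstrassP z ^ 2 -
      (m * L.weierstrassP z + n) ^ 2 = K * ((L.weierstrassP z - a) * (L.weierstrassP z - b) *
        (L.weierstrassP z - c)) := by
    have e := hk z hz
    have e' := hk (-z) (by simpa using hz)
    rw [show -z - α = -(z + α) by ring, show -z + β = -(z - β) by ring,
      show -z + α - β = -(z + (β - α)) by ring] at e'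
    rw [show z + α - β = z - (β - α) by ring] at e
    simp only [weierstrassSigma_neg, weierstrassP_neg, derivWeierstrassP_neg] at e'
    have hσ : k ^ 2 * L.weierstrassSigma z ^ 6 ≠ 0 :=
      mul_ne_zero (pow_ne_zero 2 hk0) (pow_ne_zero 6 (L.weierstrassSigma_ne_zero hz))
    have f₁ := h₁ z hz
    have f₂ := h₂ z hz
    have f₃ := h₃ z hz
    have hprod : k₁ * L.weierstrassSigma z ^ 2 * (L.weierstrassP z - a) *
        (k₂ * L.weierstrassSigma z ^ 2 * (L.weierstrassP z - b)) *
        (k₃ * L.weierstrassSigma z ^ 2 * (L.weierstrassP z - c)) =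
        -((k * L.weierstrassSigma z ^ 3 * (L.derivWeierstrassP z - (m * L.weierstrassP z + n))) *
        (k * (-L.weierstrassSigma z) ^ 3 *
          (-L.derivWeierstrassP z - (m * L.weierstrassP z + n)))) := by
      rw [← f₁, ← f₂, ← f₃, ← e, ← e']; ring
    refine mul_left_cancel₀ hσ ?_
    rw [hK]
    field_simp
    linear_combination hprod
  -- compare coefficients with the Weierstrass equation
  have hpoly : (⟨4 - K, K * (a + b + c) - m ^ 2, -L.g₂ - 2 * m * n - K * (a * b + b * c + c * a),
      -L.g₃ - n ^ 2 + K * (a * b * c)⟩ : Cubic ℂ).toPoly = 0 := by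
    refine L.polynomial_eq_zero_of_forall_eval_weierstrassP fun z hz ↦ ?_
    simp only [Cubic.toPoly, Polynomial.eval_add, Polynomial.eval_mul, Polynomial.eval_C,
      Polynomial.eval_pow, Polynomial.eval_X]
    linear_combination hcub z hz - L.derivWeierstrassP_sq z hz
  have hK4 : K = 4 := by
    have := congrArg (Polynomial.coeff · 3) hpoly
    simp only [Cubic.coeff_eq_a, Polynomial.coeff_zero] at this
    linear_combination -this
  have hsum : K * (a + b + c) - m ^ 2 = 0 := by
    simpa only [Cubic.coeff_eq_b, Polynomial.coeff_zero] using
      congrArg (Polynomial.coeff · 2) hpoly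
  rw [hK4] at hsum hcub
  exact ⟨hC, fun z hz ↦ by linear_combination hcub z hz, by linear_combination hsum / 4⟩

/-- The addition theorem for `℘`. -/
lemma weierstrassP_add {u v : ℂ} (hu : u ∉ L.lattice) (hv : v ∉ L.lattice)
    (huv : L.weierstrassP u ≠ L.weierstrassP v) :
    L.weierstrassP (u + v) = ((L.derivWeierstrassP u - L.derivWeierstrassP v) /
      (L.weierstrassP u - L.weierstrassP v)) ^ 2 / 4 - L.weierstrassP u - L.weierstrassP v := by
  have hadd : v - -u ∉ L.lattice := fun h ↦ huv ((L.weierstrassP_eq_iff hu hv).mpr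
    (.inl (by simpa [add_comm] using h)))
  have h0 := sub_ne_zero.mpr huv
  set m := (L.derivWeierstrassP u - L.derivWeierstrassP v) / (L.weierstrassP u - L.weierstrassP v)
    with hm
  have hm' : m * (L.weierstrassP u - L.weierstrassP v) =
      L.derivWeierstrassP u - L.derivWeierstrassP v := div_mul_cancel₀ _ h0
  have h := (L.weierstrassP_collinear (α := -u) (β := v) (m := -m)
    (n := m * L.weierstrassP u - L.derivWeierstrassP u) (by simpa using hu) hv hadd (by simpa)
    (by rw [weierstrassP_neg, derivWeierstrassP_neg]; ring)
    (by linear_combination -hm')).2.2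
  rw [show v - -u = u + v by ring, weierstrassP_neg] at h
  linear_combination h

end PeriodPair

/-! ### The identity on the cubic curve -/

/-- The identity for points of a plane cubic, with denominators cleared. The points `(a, A)`,
`(b, -B)`, `(c, C)` lie on a line `y = ℓ(x)` of slope `m`, the point of abscissa `p` and ordinate
`(U + V) / 2` is not on it, `U - V = 2 ℓ(p)`, and `x, y, z` are `p - a, p - b, p - c`. The curve is
`U V = 4 x y z`, and the slope determines `p` through `a + b + c = m² / 4`. Hence `x, y, z, m, U`
are independent coordinates, in which the identity is one of rational functions. -/
lemma cubic_curve_identity {x y z m p U V A B C X Y Z : ℂ} (hU : U ≠ 0) (hx : x ≠ 0) (hy : y ≠ 0)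
    (hz : z ≠ 0)
    (hp : p = (m ^ 2 / 4 + x + y + z) / 3) (hV : V = 4 * x * y * z / U)
    (hA : A = (U - V) / 2 - m * x) (hB : B = -((U - V) / 2 - m * y))
    (hC : C = (U - V) / 2 - m * z) (a b c : ℂ) (ha : a = p - x) (hb : b = p - y) (hc : c = p - z) :
    (y - x) * (U ^ 2 * ((X - (p - y - z + m * (2 * y * z / U) + (2 * y * z / U) ^ 2)) *
        (Y - (p - x - z + m * (2 * x * z / U) + (2 * x * z / U) ^ 2)) *
        (Z - (p - x - y + m * (2 * x * y / U) + (2 * x * y / U) ^ 2)))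
      - V ^ 2 * ((X - (p - y - z - m * (2 * y * z / V) + (2 * y * z / V) ^ 2)) *
        (Y - (p - x - z - m * (2 * x * z / V) + (2 * x * z / V) ^ 2)) *
        (Z - (p - x - y - m * (2 * x * y / V) + (2 * x * y / V) ^ 2))))
    = 2 * (U + V) *
      ((-a * B - b * A) * (p * (X * Y + Y * Z + X * Z) + X * Y * Z)
        + (b ^ 2 * A + a ^ 2 * B) * (Z * p + X * Y)
        + ((b ^ 2 * A + a ^ 2 * B) - B * (a - b) * (a - c)) * (X * p + Y * Z)
        + (-A * (b - a) * (b - c) + (b ^ 2 * A + a ^ 2 * B)) * (Y * p + X * Z)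
        + (a * B * (a - b) * (a - c) + b * A * (b - a) * (b - c) - A * b ^ 3 - B * a ^ 3)
          * (p + X + Y + Z)
        + A * (b ^ 2 - (a - b) * (c - b)) ^ 2 + B * (a ^ 2 - (b - a) * (c - a)) ^ 2
        - A * B * C * (a - b)
        + (A + B) * X * Y * Z * p) := by
  -- differences with `p` keep the expanded polynomials small
  obtain ⟨X, rfl⟩ : ∃ X', X = X' + p := ⟨X - p, by ring⟩
  obtain ⟨Y, rfl⟩ : ∃ X', Y = X' + p := ⟨Y - p, by ring⟩
  obtain ⟨Z, rfl⟩ : ∃ X', Z = X' + p := ⟨Z - p, by ring⟩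
  have h1 : 2 * y * z / V = U / (2 * x) := by rw [hV]; field_simp; norm_num
  have h2 : 2 * x * z / V = U / (2 * y) := by rw [hV]; field_simp; norm_num
  have h3 : 2 * x * y / V = U / (2 * z) := by rw [hV]; field_simp; norm_num
  rw [h1, h2, h3]
  subst ha hb hc hA hB hC hV hp
  field_simp
  ring

/-- The chord formula for the sum of `(p, P)` and `(a, A)`, in terms of the line of slope `m`
through `(a, A)`. -/
lemma chord_formula {p P a A b c m U V : ℂ} (hU : U ≠ 0) (hpa : p - a ≠ 0)
    (hUV : U * V = 4 * (p - a) * (p - b) * (p - c)) (hPA : P - A = V + m * (p - a))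
    (hm : a + b + c = m ^ 2 / 4) :
    ((P - A) / (p - a)) ^ 2 / 4 - p - a = p - (p - b) - (p - c) +
      m * (2 * (p - b) * (p - c) / U) + (2 * (p - b) * (p - c) / U) ^ 2 := by
  have h : (P - A) / (p - a) = 2 * (2 * (p - b) * (p - c) / U) + m := by
    rw [hPA]
    field_simp
    linear_combination hUV
  rw [h]
  linear_combination -hm

theorem proposition3p1 (L : PeriodPair) (ξ α β γ : ℂ) (hγ : γ = β - α)
    -- none of the arguments of `℘` below is a pole, and the denominator of `t` does not vanish
    (hξ_pole : ξ ∉ L.lattice) (hα_pole : α ∉ L.lattice) (hβ_pole : β ∉ L.lattice)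
    (hγ_pole : γ ∉ L.lattice)
    (hξα_add : ξ + α ∉ L.lattice) (hξα_sub : ξ - α ∉ L.lattice)
    (hξβ_add : ξ + β ∉ L.lattice) (hξβ_sub : ξ - β ∉ L.lattice)
    (hξαβ : ξ + α - β ∉ L.lattice) (hξβα : ξ - α + β ∉ L.lattice)
    -- the points `(a, A)`, `(b, B)`, `(c, C)` of the Weierstrass curve
    (a A b B c C : ℂ)
    (ha : a = L.weierstrassP α) (hA : A = L.derivWeierstrassP α)
    (hb : b = L.weierstrassP β) (hB : B = L.derivWeierstrassP β)
    (hc : c = L.weierstrassP γ) (hC : C = L.derivWeierstrassP γ)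
    -- the denominator of `s` does not vanish
    (hden : (A + B) * L.weierstrassP ξ - A * b - a * B ≠ 0)
    (t s : ℂ)
    (ht : t =
      (L.weierstrassSigma (ξ - α) * L.weierstrassSigma (ξ + β) * L.weierstrassSigma (ξ + α - β)) /
      (L.weierstrassSigma (ξ + α) * L.weierstrassSigma (ξ - β) * L.weierstrassSigma (ξ - α + β)))
    (hs : s = (1 - t ^ 2) / ((A + B) * L.weierstrassP ξ - A * b - a * B))
    (X Y Z : ℂ) :
    (X - L.weierstrassP (ξ + α)) * (Y - L.weierstrassP (ξ - β)) *
        (Z - L.weierstrassP (ξ - α + β))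
      - t ^ 2 * (X - L.weierstrassP (ξ - α)) * (Y - L.weierstrassP (ξ + β)) *
        (Z - L.weierstrassP (ξ + α - β))
    = s *
      ((-a * B - b * A) * (L.weierstrassP ξ * (X * Y + Y * Z + X * Z) + X * Y * Z)
        + (b ^ 2 * A + a ^ 2 * B) * (Z * L.weierstrassP ξ + X * Y)
        + ((b ^ 2 * A + a ^ 2 * B) - B * (a - b) * (a - c)) * (X * L.weierstrassP ξ + Y * Z)
        + (-A * (b - a) * (b - c) + (b ^ 2 * A + a ^ 2 * B)) * (Y * L.weierstrassP ξ + X * Z)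
        + (a * B * (a - b) * (a - c) + b * A * (b - a) * (b - c) - A * b ^ 3 - B * a ^ 3)
          * (L.weierstrassP ξ + X + Y + Z)
        + A * (b ^ 2 - (a - b) * (c - b)) ^ 2 + B * (a ^ 2 - (b - a) * (c - a)) ^ 2
        - A * B * C * (a - b)
        + (A + B) * X * Y * Z * L.weierstrassP ξ) := by
  subst hγ
  have hne : L.weierstrassP α ≠ L.weierstrassP β := by
    rw [Ne, L.weierstrassP_eq_iff hα_pole hβ_pole]
    rintro (h | h)
    · -- `β = -α` modulo the lattice makes the denominator of `s` vanish
      have e₁ : L.weierstrassP β = L.weierstrassP α := by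
        simpa using L.weierstrassP_add_coe (-α) ⟨α + β, h⟩
      have e₂ : L.derivWeierstrassP β = -L.derivWeierstrassP α := by
        simpa using L.derivWeierstrassP_add_coe (-α) ⟨α + β, h⟩
      refine hden ?_
      rw [hA, hB, ha, hb, e₁, e₂]
      ring
    · exact hγ_pole (by simpa using neg_mem h)
  have hab : a - b ≠ 0 := by rwa [ha, hb, sub_ne_zero]
  obtain ⟨m, hm⟩ : ∃ m, m = (A + B) / (a - b) := ⟨_, rfl⟩
  rw [eq_div_iff hab] at hm
  obtain ⟨n, hn⟩ : ∃ n, A = m * a + n := ⟨A - m * a, by ring⟩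
  have hBn : -B = m * b + n := by linear_combination hn + hm
  obtain ⟨hCn, hcurve, hsum⟩ := L.weierstrassP_collinear (m := m) (n := n) hα_pole hβ_pole hγ_pole
    hne (by rw [← hA, ← ha, hn]) (by rw [← hB, ← hb, hBn])
  obtain ⟨k, hk0, hk⟩ := L.exists_weierstrassSigma_mul_eq_line (m := m) (n := n) hα_pole hβ_pole
    hne (by rw [← hA, ← ha, hn]) (by rw [← hB, ← hb, hBn])
  rw [← ha, ← hb, ← hc] at hsum
  rw [← hC, ← hc] at hCn
  have hcurve := hcurve ξ hξ_pole
  rw [← ha, ← hb, ← hc] at hcurve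
  have hpa : L.weierstrassP ξ ≠ a := by
    rw [ha, Ne, L.weierstrassP_eq_iff hξ_pole hα_pole, not_or]
    exact ⟨hξα_add, hξα_sub⟩
  have hpb : L.weierstrassP ξ ≠ b := by
    rw [hb, Ne, L.weierstrassP_eq_iff hξ_pole hβ_pole, not_or]
    exact ⟨hξβ_add, hξβ_sub⟩
  have hpc : L.weierstrassP ξ ≠ c := by
    rw [hc, Ne, L.weierstrassP_eq_iff hξ_pole hγ_pole, not_or]
    exact ⟨by rwa [show ξ + (β - α) = ξ - α + β by ring],
      by rwa [show ξ - (β - α) = ξ + α - β by ring]⟩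
  -- the six values of `℘` by the addition theorem
  have e₁ := L.weierstrassP_add hξ_pole hα_pole (ha ▸ hpa)
  have e₂ := L.weierstrassP_add hξ_pole (neg_mem_iff.not.mpr hβ_pole)
    (by rw [L.weierstrassP_neg]; exact hb ▸ hpb)
  have e₃ := L.weierstrassP_add hξ_pole hγ_pole (hc ▸ hpc)
  have f₁ := L.weierstrassP_add hξ_pole (neg_mem_iff.not.mpr hα_pole)
    (by rw [L.weierstrassP_neg]; exact ha ▸ hpa)
  have f₂ := L.weierstrassP_add hξ_pole hβ_pole (hb ▸ hpb)
  have f₃ := L.weierstrassP_add hξ_pole (neg_mem_iff.not.mpr hγ_pole)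
    (by rw [L.weierstrassP_neg]; exact hc ▸ hpc)
  rw [← ha, ← hA] at e₁
  rw [L.weierstrassP_neg, L.derivWeierstrassP_neg, ← hb, ← hB, ← sub_eq_add_neg] at e₂
  rw [← hc, ← hC, show ξ + (β - α) = ξ - α + β by ring] at e₃
  rw [L.weierstrassP_neg, L.derivWeierstrassP_neg, ← ha, ← hA, ← sub_eq_add_neg] at f₁
  rw [← hb, ← hB] at f₂
  rw [L.weierstrassP_neg, L.derivWeierstrassP_neg, ← hc, ← hC,
    show ξ + -(β - α) = ξ + α - β by ring] at f₃
  -- the numerator of `t` is the line at `ξ`, and its denominator minus the line at `-ξ`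
  have hnum := hk ξ hξ_pole
  have hdenom := hk (-ξ) (neg_mem_iff.not.mpr hξ_pole)
  rw [show -ξ - α = -(ξ + α) by ring, show -ξ + β = -(ξ - β) by ring,
    show -ξ + α - β = -(ξ - α + β) by ring] at hdenom
  simp only [L.weierstrassSigma_neg, L.weierstrassP_neg, L.derivWeierstrassP_neg] at hdenom
  have hσ := L.weierstrassSigma_ne_zero hξ_pole
  generalize L.weierstrassP ξ = p at *
  generalize L.derivWeierstrassP ξ = P at *
  generalize L.weierstrassSigma ξ = σ₀ at *
  obtain ⟨U, hU⟩ : ∃ U, U = P + (m * p + n) := ⟨_, rfl⟩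
  obtain ⟨V, hV⟩ : ∃ V, V = P - (m * p + n) := ⟨_, rfl⟩
  rw [← sub_ne_zero] at hpa hpb hpc
  have hUV : U * V = 4 * (p - a) * (p - b) * (p - c) := by
    rw [hU, hV]; linear_combination hcurve
  have hUV0 : U * V ≠ 0 := by
    rw [hUV]; exact mul_ne_zero (mul_ne_zero (mul_ne_zero (by norm_num) hpa) hpb) hpc
  have hU0 : U ≠ 0 := left_ne_zero_of_mul hUV0
  have hV0 : V ≠ 0 := right_ne_zero_of_mul hUV0
  have hD : (A + B) * p - A * b - a * B = (U - V) / 2 * (a - b) := by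
    rw [hU, hV]; linear_combination -p * hm + (a - b) * hn + a * hm
  have ht2 : t ^ 2 = V ^ 2 / U ^ 2 := by
    have h : t = -(V / U) := by
      have hd : L.weierstrassSigma (ξ + α) * L.weierstrassSigma (ξ - β) *
          L.weierstrassSigma (ξ - α + β) = -(k * σ₀ ^ 3 * U) := by
        rw [hU]; linear_combination -hdenom
      rw [ht, hnum, hd, ← hV]
      field_simp
    rw [h, neg_sq, div_pow]
  have hs' : s = 2 * (U + V) / (U ^ 2 * (a - b)) := by
    have h1 : U - V ≠ 0 := by
      rintro h
      rw [hD, h] at hden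
      simp at hden
    rw [hs, hD, ht2]
    field_simp
    ring
  have g₁ := chord_formula (A := A) (P := P) (m := m) (b := b) (c := c) hU0 hpa hUV
    (by rw [hV, hn]; ring) hsum
  have g₂ := chord_formula (A := -B) (P := P) (m := m) (b := a) (c := c) (V := V) hU0 hpb
    (by rw [hUV]; ring) (by rw [hV, hBn]; ring) (by rw [← hsum]; ring)
  have g₃ := chord_formula (A := C) (P := P) (m := m) (b := a) (c := b) (V := V) hU0 hpc
    (by rw [hUV]; ring) (by rw [hV, hCn]; ring) (by rw [← hsum]; ring)
  have k₁ := chord_formula (A := -A) (P := P) (m := -m) (b := b) (c := c) (V := U) hV0 hpa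
    (by rw [mul_comm, hUV]) (by rw [hU, hn]; ring) (by rw [hsum]; ring)
  have k₂ := chord_formula (A := B) (P := P) (m := -m) (b := a) (c := c) (V := U) hV0 hpb
    (by rw [mul_comm, hUV]; ring) (by rw [hU]; linear_combination hBn) (by rw [neg_sq, ← hsum]; ring)
  have k₃ := chord_formula (A := -C) (P := P) (m := -m) (b := a) (c := b) (V := U) hV0 hpc
    (by rw [mul_comm, hUV]; ring) (by rw [hU, hCn]; ring) (by rw [neg_sq, ← hsum]; ring)
  rw [e₁, e₂, e₃, f₁, f₂, f₃, g₁, g₂, g₃, k₁, k₂, k₃, ht2, hs']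
  have key := cubic_curve_identity (x := p - a) (y := p - b) (z := p - c) (m := m) (p := p) (U := U)
    (V := V) (A := A) (B := B) (C := C) (X := X) (Y := Y) (Z := Z) hU0 hpa hpb hpc
    (by linear_combination hsum / 3)
    (by rw [eq_div_iff hU0, mul_comm, hUV])
    (by rw [hU, hV, hn]; ring) (by rw [hU, hV]; linear_combination -hBn)
    (by rw [hU, hV, hCn]; ring) a b c (by ring) (by ring) (by ring)
  have hU2 : U ^ 2 * (a - b) ≠ 0 := mul_ne_zero (pow_ne_zero 2 hU0) hab
  refine mul_left_cancel₀ hU2 ?_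
  rw [← mul_assoc, mul_div_cancel₀ _ hU2, ← key]
  generalize 2 * (p - b) * (p - c) / U = r₁
  generalize 2 * (p - a) * (p - c) / U = r₂
  generalize 2 * (p - a) * (p - b) / U = r₃
  generalize 2 * (p - b) * (p - c) / V = s₁
  generalize 2 * (p - a) * (p - c) / V = s₂
  generalize 2 * (p - a) * (p - b) / V = s₃
  have hd : U ^ 2 * (V ^ 2 / U ^ 2) = V ^ 2 := mul_div_cancel₀ _ (pow_ne_zero 2 hU0)
  generalize V ^ 2 / U ^ 2 = w at hd
  rw [← hd]
  ring
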